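/- Let $\{0,1\}^\infty$ be the set of infinite binary sequences and let $G=\langle a,b\rangle$ be the group of transformations of $\{0,1\}^\infty$ generated by $a$ and $b$, where $$a(0w)=1w,\quad a(1w)=0\,a(w),\quad b(0w)=0\,b(w),\quad b(1w)=1\,a(w)\qquad (w\in\{0,1\}^\infty),$$ that is, $a=(e,a)\sigma$ and $b=(b,a)$. For $\omega\in\{0,1\}^\infty$ let $\Gamma_\omega$ be the orbital Schreier graph of $\omega$: its vertex set is the orbit $G(\omega)$, with an edge between $v$ and $s(v)$ for every $v\in G(\omega)$ and $s\in\{a,b\}$. For $\omega=x_1x_2\dots$ let $X_\omega$ be the graph with vertex set $\mathbb Z$ and edges $(z,z+1)$ and $(2^nz-a_n^\omega,\,2^n(z+1)-a_n^\omega)$ for all $z\in\mathbb Z$ and $n\ge 1$, where $a_n^\omega=\sum_{i=1}^n x_i2^{i-1}-2^{n-1}$ (together with a loop at the vertex, if there is one, that is on no edge of the second kind). For a vertex $v$ of a graph $X$ write $\gamma_v(n)=|B(v,n)|$ for the number of vertices at distance at most $n$ from $v$. A connected graph of uniformly bounded valence has intermediate growth if, for every vertex $v$, $\gamma_v$ is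 superpolynomial (for every polynomial $P$, $\gamma_v(n)\ge P(n)$ for all large $n$) and subexponential (for every $c>1$, $\gamma_v(n)\le c^n$ for all large $n$). Theorem. For every $\omega\in\{0,1\}^\infty$ the graphs $\Gamma_\omega$ and $X_\omega$ are connected, of uniformly bounded valence, and have intermediate growth. Moreover, there is a constant $C>0$ such that for every $\omega\in\{0,1\}^\infty$, every vertex $v$ of $\Gamma_\omega$ or of $X_\omega$, and every integer $n\ge 2$, $$n^{\frac12\log_2 n-\log_2\log_2 n-C}\;\le\;\gamma_v(n)\;\le\;(Cn)^{\log_2(Cn)}.$$ -/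

import Mathlib

open Filter

/-! ### Binary sequences and the group generated by `a` and `b` -/

/-- The space `{0,1}^∞` of infinite binary sequences. The letter `x_{i+1}` of `ω = x₁x₂…` is `ω i`,
with `false` for `0` and `true` for `1`. -/
abbrev BinSeq : Type := ℕ → Bool

namespace BinSeq

/-- The sequence `x ω`, with first letter `x` followed by the sequence `ω`. -/
def cons (x : Bool) (ω : BinSeq) : BinSeq
  | 0 => x
  | n + 1 => ω n

/-- The shifted sequence `x₂x₃…` of `x₁x₂x₃…`. -/
def tail (ω : BinSeq) : BinSeq := fun n => ω (n + 1)

theorem tail_cons (x : Bool) (ω : BinSeq) : (cons x ω).tail = ω := rfl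

theorem cons_head_tail (ω : BinSeq) : cons (ω 0) ω.tail = ω := by
  funext n; cases n <;> rfl

/-- The `n`-th letter of `a(ω)`, where `a(0ω) = 1ω` and `a(1ω) = 0a(ω)`. -/
def aLetter : ℕ → BinSeq → Bool
  | 0, ω => !ω 0
  | n + 1, ω => if ω 0 then aLetter n ω.tail else ω (n + 1)

/-- The `n`-th letter of `a⁻¹(ω)`, where `a⁻¹(1ω) = 0ω` and `a⁻¹(0ω) = 1a⁻¹(ω)`. -/
def aInvLetter : ℕ → BinSeq → Bool
  | 0, ω => !ω 0
  | n + 1, ω => if ω 0 then ω (n + 1) else aInvLetter n ω.tail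

/-- The `n`-th letter of `b(ω)`, where `b(0ω) = 0b(ω)` and `b(1ω) = 1a(ω)`. -/
def bLetter : ℕ → BinSeq → Bool
  | 0, ω => ω 0
  | n + 1, ω => if ω 0 then aLetter n ω.tail else bLetter n ω.tail

/-- The `n`-th letter of `b⁻¹(ω)`, where `b⁻¹(0ω) = 0b⁻¹(ω)` and `b⁻¹(1ω) = 1a⁻¹(ω)`. -/
def bInvLetter : ℕ → BinSeq → Bool
  | 0, ω => ω 0
  | n + 1, ω => if ω 0 then aInvLetter n ω.tail else bInvLetter n ω.tail

theorem aInvLetter_aLetter (n : ℕ) : ∀ ω : BinSeq, aInvLetter n (fun i => aLetter i ω) = ω n := by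
  induction n with
  | zero => intro ω; simp [aInvLetter, aLetter]
  | succ n ih =>
    intro ω
    cases h : ω 0
    · simp [aInvLetter, aLetter, h]
    · have e : tail (fun i => aLetter i ω) = fun i => aLetter i ω.tail := by
        funext i; simp [tail, aLetter, h]
      have t : _ = ω (n + 1) := ih ω.tail
      simpa [aInvLetter, aLetter, h, e] using t

theorem aLetter_aInvLetter (n : ℕ) : ∀ ω : BinSeq, aLetter n (fun i => aInvLetter i ω) = ω n := by
  induction n with
  | zero => intro ω; simp [aInvLetter, aLetter]
  | succ n ih =>
    intro ω
    cases h : ω 0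
    · have e : tail (fun i => aInvLetter i ω) = fun i => aInvLetter i ω.tail := by
        funext i; simp [tail, aInvLetter, h]
      have t : _ = ω (n + 1) := ih ω.tail
      simpa [aLetter, aInvLetter, h, e] using t
    · simp [aInvLetter, aLetter, h]

theorem bInvLetter_bLetter (n : ℕ) : ∀ ω : BinSeq, bInvLetter n (fun i => bLetter i ω) = ω n := by
  induction n with
  | zero => intro ω; simp [bInvLetter, bLetter]
  | succ n ih =>
    intro ω
    cases h : ω 0
    · have e : tail (fun i => bLetter i ω) = fun i => bLetter i ω.tail := by
        funext i; simp [tail, bLetter, h]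
      have t : _ = ω (n + 1) := ih ω.tail
      simpa [bInvLetter, bLetter, h, e] using t
    · have e : tail (fun i => bLetter i ω) = fun i => aLetter i ω.tail := by
        funext i; simp [tail, bLetter, h]
      have t : _ = ω (n + 1) := aInvLetter_aLetter n ω.tail
      simpa [bInvLetter, bLetter, h, e] using t

theorem bLetter_bInvLetter (n : ℕ) : ∀ ω : BinSeq, bLetter n (fun i => bInvLetter i ω) = ω n := by
  induction n with
  | zero => intro ω; simp [bInvLetter, bLetter]
  | succ n ih =>
    intro ω
    cases h : ω 0
    · have e : tail (fun i => bInvLetter i ω) = fun i => bInvLetter i ω.tail := by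
        funext i; simp [tail, bInvLetter, h]
      have t : _ = ω (n + 1) := ih ω.tail
      simpa [bLetter, bInvLetter, h, e] using t
    · have e : tail (fun i => bInvLetter i ω) = fun i => aInvLetter i ω.tail := by
        funext i; simp [tail, bInvLetter, h]
      have t : _ = ω (n + 1) := aLetter_aInvLetter n ω.tail
      simpa [bLetter, bInvLetter, h, e] using t

/-- The transformation `a = (e, a)σ` of `{0,1}^∞` (the binary adding machine). -/
def a : Equiv.Perm BinSeq where
  toFun ω n := aLetter n ω
  invFun ω n := aInvLetter n ω
  left_inv ω := funext fun n => aInvLetter_aLetter n ω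
  right_inv ω := funext fun n => aLetter_aInvLetter n ω

/-- The transformation `b = (b, a)` of `{0,1}^∞`. -/
def b : Equiv.Perm BinSeq where
  toFun ω n := bLetter n ω
  invFun ω n := bInvLetter n ω
  left_inv ω := funext fun n => bInvLetter_bLetter n ω
  right_inv ω := funext fun n => bLetter_bInvLetter n ω

theorem a_cons_zero (ω : BinSeq) : a (cons false ω) = cons true ω := by
  funext n; cases n <;> rfl

theorem a_cons_one (ω : BinSeq) : a (cons true ω) = cons false (a ω) := by
  funext n; cases n <;> rfl

theorem b_cons_zero (ω : BinSeq) : b (cons false ω) = cons false (b ω) := by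
  funext n; cases n <;> rfl

theorem b_cons_one (ω : BinSeq) : b (cons true ω) = cons true (a ω) := by
  funext n; cases n <;> rfl

/-- The self-similar group `G = ⟨a, b⟩`, acting on `{0,1}^∞`. -/
def G : Subgroup (Equiv.Perm BinSeq) := Subgroup.closure {a, b}

/-- The labels of the two generators. -/
inductive Gen : Type
  | a
  | b

/-- The generators `a` and `b` as elements of `G`. -/
def gen : Gen → G
  | Gen.a => ⟨a, Subgroup.subset_closure (Or.inl rfl)⟩
  | Gen.b => ⟨b, Subgroup.subset_closure (Or.inr rfl)⟩

/-- The orbital Schreier graph `Γ_ω`: its vertices are the points of the orbit `G(ω)`, with an edge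
labelled `s` from `v` to `s(v)` for every vertex `v` and every `s ∈ {a, b}`. -/
abbrev OrbitalSchreierGraph (ω : BinSeq) : Type :=
  Quiver.SchreierGraph (MulAction.orbit G ω) gen

/-- The integer `a_n^ω = ∑_{i=1}^n x_i 2^{i-1} - 2^{n-1}`, for `n ≥ 1`. -/
def aCoeff (ω : BinSeq) (n : ℕ) : ℤ :=
  (∑ i ∈ Finset.range n, ((ω i).toNat : ℤ) * 2 ^ i) - 2 ^ (n - 1)

/-- The graph `X_ω` on `ℤ`, with the edges `(z, z + 1)` and
`(2^n z - a_n^ω, 2^n (z + 1) - a_n^ω)` for `n ≥ 1`, `z ∈ ℤ`. (The possible loop of `X_ω` at one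
vertex has no effect on distances and is left out.) -/
def xGraph (ω : BinSeq) : SimpleGraph ℤ :=
  SimpleGraph.fromRel fun u v =>
    v = u + 1 ∨ ∃ n : ℕ, 1 ≤ n ∧ ∃ z : ℤ,
      u = 2 ^ n * z - aCoeff ω n ∧ v = 2 ^ n * (z + 1) - aCoeff ω n

end BinSeq

/-! ### Growth of graphs -/

/-- The simple graph underlying a directed graph with loops and multiple edges: orientations,
labels, loops and multiplicities, none of which affects distances, are forgotten. -/
def underlyingGraph (V : Type*) [Quiver V] : SimpleGraph V :=
  SimpleGraph.fromRel fun u v => Nonempty (u ⟶ v)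

namespace SimpleGraph

variable {V : Type*}

/-- The closed ball `B(v, n)` for the graph distance. -/
def growthBall (X : SimpleGraph V) (v : V) (n : ℕ) : Set V :=
  {u | X.edist v u ≤ n}

/-- The growth function `γ_v(n) = |B(v, n)|` (used for graphs whose balls are finite). -/
noncomputable def growth (X : SimpleGraph V) (v : V) (n : ℕ) : ℕ :=
  (X.growthBall v n).ncard

/-- A connected graph of uniformly bounded valence has intermediate growth if its growth function
eventually dominates every polynomial and is eventually dominated by every exponential function
`c ^ n` with `c > 1`. -/
structure HasIntermediateGrowth (X : SimpleGraph V) : Prop where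
  connected : X.Connected
  bounded_valence : ∃ d : ℕ, ∀ v : V, (X.neighborSet v).encard ≤ d
  superpolynomial : ∀ v : V, ∀ P : Polynomial ℝ,
    ∀ᶠ n : ℕ in atTop, P.eval (n : ℝ) ≤ (X.growth v n : ℝ)
  subexponential : ∀ v : V, ∀ c : ℝ, 1 < c →
    ∀ᶠ n : ℕ in atTop, (X.growth v n : ℝ) ≤ c ^ n

end SimpleGraph

/-!
The map `z ↦ a ^ z (ω)` is an isomorphism from `X_ω` to `Γ_ω` (`BinSeq.xGraphIso`): `a` adds `1` to
a `2`-adic integer, and `b` adds `2 ^ (k + 1)` to a `2`-adic integer of valuation `k` and fixes `0`.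
So only `X_ω` has to be studied. Call the valuation of `z + ω` the depth of the vertex `z`; the
edges of `X_ω` are the pairs `(z, z + 1)` and the pairs `(z, z + 2 ^ (k + 1))` with `z` of depth
`k`.

Lower bound. Let `T k` be the largest distance between consecutive vertices of depth at least `k`,
which are `2 ^ k` apart in `ℤ`. To travel `2 ^ k`, a path can move to the line of vertices of depth
exactly `j`, follow it, and leave it, which gives `T k ≤ 2 * T j + 2 ^ (k - j - 1)` for `j < k`.
Along the sequence `k = i (i + 1) / 2` this yields `T k ≤ (i + 1) 2 ^ i`, and summing over `i` shows
that a ball of radius `(i + 1) 2 ^ (i + 2)` contains a dyadic interval of length `2 ^ k`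
(`BinSeq.exists_interval_subset_growthBall`).

Upper bound. Two vertices of depth at least `K = (r + 1) (r + 2) / 2` but of different depths are
at distance more than `2 ^ r` (`BinSeq.deep_iff_of_path`): a shortest path between such vertices has
no other vertex of depth `≥ K`, and covers at least `2 ^ K` in `ℤ`, so if it had at most `2 ^ r`
edges then one of them would be long, hence of depth only slightly less than `K`; induction applies
to both parts of the path. Consequently, a ball of radius `n ≤ 2 ^ (r - 1)` involves edges of at
most one length larger than `2 ^ K`, and its points are `v + m 2 ^ d + s` with a fixed `d`, with
`|m| ≤ n` and `|s| ≤ n 2 ^ K` (`BinSeq.growthBall_subset`).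

Both bounds hold with `C = 32`, and intermediate growth follows from them.
-/

namespace BinSeq

/-! ### Depth of the integers relative to a sequence -/

/-- The integer `∑_{i < n} x_{i+1} 2^i` whose binary digits are the first `n` letters of `ω`. -/
def prefixVal (n : ℕ) (ω : BinSeq) : ℤ :=
  ∑ i ∈ Finset.range n, ((ω i).toNat : ℤ) * 2 ^ i

theorem prefixVal_succ (n : ℕ) (ω : BinSeq) :
    prefixVal (n + 1) ω = prefixVal n ω + ((ω n).toNat : ℤ) * 2 ^ n := by
  simp [prefixVal, Finset.sum_range_succ]

theorem aCoeff_succ (n : ℕ) (ω : BinSeq) : aCoeff ω (n + 1) = prefixVal (n + 1) ω - 2 ^ n := rfl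

/-- `Deep ω k z`: the `2`-adic integer `z + ω` is divisible by `2 ^ k`. -/
def Deep (ω : BinSeq) (k : ℕ) (z : ℤ) : Prop := (2 : ℤ) ^ k ∣ z + prefixVal k ω

/-- `ExactDepth ω k z`: the `2`-adic valuation of `z + ω` is `k`. These `z` are the vertices of
`X_ω` on edges of length `2 ^ (k + 1)`. -/
def ExactDepth (ω : BinSeq) (k : ℕ) (z : ℤ) : Prop := Deep ω k z ∧ ¬ Deep ω (k + 1) z

theorem deep_zero (ω : BinSeq) (z : ℤ) : Deep ω 0 z := by simp [Deep]

theorem Deep.of_succ {ω : BinSeq} {k : ℕ} {z : ℤ} (h : Deep ω (k + 1) z) : Deep ω k z := by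
  obtain ⟨m, hm⟩ := h
  rw [prefixVal_succ] at hm
  exact ⟨2 * m - ((ω k).toNat : ℤ), by rw [pow_succ] at hm; linear_combination hm⟩

theorem Deep.mono {ω : BinSeq} {j k : ℕ} {z : ℤ} (hjk : j ≤ k) (h : Deep ω k z) : Deep ω j z := by
  induction k, hjk using Nat.le_induction with
  | base => exact h
  | succ k _ ih => exact ih h.of_succ

theorem Deep.dvd_sub {ω : BinSeq} {k : ℕ} {u v : ℤ} (hu : Deep ω k u) (hv : Deep ω k v) :
    (2 : ℤ) ^ k ∣ v - u := by
  simpa using Int.dvd_sub hv hu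

theorem Deep.of_dvd_sub {ω : BinSeq} {k : ℕ} {u v : ℤ} (hu : Deep ω k u)
    (h : (2 : ℤ) ^ k ∣ v - u) : Deep ω k v := by
  have := Int.dvd_add hu h
  rw [Deep]; convert this using 1; ring

theorem exactDepth_iff {ω : BinSeq} {k : ℕ} {z : ℤ} :
    ExactDepth ω k z ↔ (2 : ℤ) ^ (k + 1) ∣ z + aCoeff ω (k + 1) := by
  have hpos : (0 : ℤ) < 2 ^ k := by positivity
  rw [aCoeff_succ, prefixVal_succ]
  constructor
  · rintro ⟨⟨m, hm⟩, h⟩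
    rw [Deep, prefixVal_succ, pow_succ] at h
    have h2 : ¬ (2 : ℤ) ∣ m + (ω k).toNat := fun ⟨c, hc⟩ =>
      h ⟨c, by linear_combination hm + 2 ^ k * hc⟩
    obtain ⟨c, hc⟩ : (2 : ℤ) ∣ m + (ω k).toNat - 1 := by omega
    exact ⟨c, by rw [pow_succ]; linear_combination hm + 2 ^ k * hc⟩
  · rintro ⟨m, hm⟩
    rw [pow_succ] at hm
    refine ⟨⟨2 * m + 1 - (ω k).toNat, by linear_combination hm⟩, ?_⟩
    rintro ⟨c, hc⟩
    rw [prefixVal_succ, pow_succ] at hc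
    have : (2 : ℤ) ^ k * (2 * c - 2 * m - 1) = 0 := by linear_combination hm - hc
    rcases mul_eq_zero.1 this with h | h
    · exact hpos.ne' h
    · omega

theorem ExactDepth.of_dvd_sub {ω : BinSeq} {k : ℕ} {u v : ℤ} (hu : ExactDepth ω k u)
    (h : (2 : ℤ) ^ (k + 1) ∣ v - u) : ExactDepth ω k v := by
  rw [exactDepth_iff] at *
  have := Int.dvd_add hu h
  convert this using 1; ring

theorem Deep.exactDepth_add {ω : BinSeq} {k : ℕ} {w : ℤ} (hw : Deep ω (k + 1) w) :
    ExactDepth ω k (w + 2 ^ k) := by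
  rw [exactDepth_iff, aCoeff_succ]
  rw [Deep] at hw
  convert hw using 1; ring

theorem ExactDepth.deep_iff {ω : BinSeq} {k m : ℕ} {z : ℤ} (h : ExactDepth ω k z) :
    Deep ω m z ↔ m ≤ k := by
  constructor
  · intro hm
    by_contra hk
    exact h.2 (hm.mono (by omega))
  · exact fun hm => h.1.mono hm

/-- Every integer lies in an interval `[w, w + 2 ^ k)` with `w` divisible by `2 ^ k` relative to
`ω`. -/
theorem exists_deep_floor (ω : BinSeq) (k : ℕ) (z : ℤ) :
    ∃ w, Deep ω k w ∧ w ≤ z ∧ z < w + 2 ^ k := by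
  have hpos : (0 : ℤ) < 2 ^ k := by positivity
  have h1 := Int.emod_add_mul_ediv (z + prefixVal k ω) (2 ^ k)
  have h2 := Int.emod_nonneg (z + prefixVal k ω) hpos.ne'
  have h3 := Int.emod_lt_of_pos (z + prefixVal k ω) hpos
  exact ⟨z - (z + prefixVal k ω) % 2 ^ k, ⟨(z + prefixVal k ω) / 2 ^ k, by linarith⟩,
    by linarith, by linarith⟩

/-! ### Edges of `X_ω` -/

theorem xGraph_rel_iff {ω : BinSeq} {u v : ℤ} :
    (v = u + 1 ∨ ∃ n : ℕ, 1 ≤ n ∧ ∃ z : ℤ,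
      u = 2 ^ n * z - aCoeff ω n ∧ v = 2 ^ n * (z + 1) - aCoeff ω n) ↔
    (v = u + 1 ∨ ∃ k, ExactDepth ω k u ∧ v = u + 2 ^ (k + 1)) := by
  refine or_congr Iff.rfl ⟨?_, ?_⟩
  · rintro ⟨_ | k, hn, z, hu, hv⟩
    · omega
    · exact ⟨k, exactDepth_iff.2 ⟨z, by linarith⟩, by linarith⟩
  · rintro ⟨k, hk, hv⟩
    obtain ⟨z, hz⟩ := exactDepth_iff.1 hk
    exact ⟨k + 1, by omega, z, by linarith, by linarith⟩

theorem xGraph_adj_iff {ω : BinSeq} {u v : ℤ} :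
    (xGraph ω).Adj u v ↔ (v = u + 1 ∨ ∃ k, ExactDepth ω k u ∧ v = u + 2 ^ (k + 1)) ∨
      (u = v + 1 ∨ ∃ k, ExactDepth ω k v ∧ u = v + 2 ^ (k + 1)) := by
  rw [xGraph, SimpleGraph.fromRel_adj, xGraph_rel_iff, xGraph_rel_iff, and_iff_right_iff_imp]
  rintro ((h | ⟨k, -, h⟩) | (h | ⟨k, -, h⟩))
  · omega
  · have : (0 : ℤ) < 2 ^ (k + 1) := by positivity
    omega
  · omega
  · have : (0 : ℤ) < 2 ^ (k + 1) := by positivity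
    omega

theorem xGraph_adj_add_one (ω : BinSeq) (z : ℤ) : (xGraph ω).Adj z (z + 1) :=
  xGraph_adj_iff.2 (Or.inl (Or.inl rfl))

theorem xGraph_adj_add_pow {ω : BinSeq} {k : ℕ} {z : ℤ} (h : ExactDepth ω k z) :
    (xGraph ω).Adj z (z + 2 ^ (k + 1)) :=
  xGraph_adj_iff.2 (Or.inl (Or.inr ⟨k, h, rfl⟩))

/-- The ends of an edge are at distance `1` in `ℤ`, or have the same depth `k` and are at distance
`2 ^ (k + 1)`. -/
theorem abs_sub_of_adj {ω : BinSeq} {u v : ℤ} (h : (xGraph ω).Adj u v) :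
    |v - u| = 1 ∨ ∃ k, ExactDepth ω k u ∧ ExactDepth ω k v ∧ |v - u| = 2 ^ (k + 1) := by
  rcases xGraph_adj_iff.1 h with (h | ⟨k, hk, h⟩) | (h | ⟨k, hk, h⟩)
  · left; subst h; simp
  · right
    subst h
    exact ⟨k, hk, hk.of_dvd_sub (by simp), by simp⟩
  · left; subst h; simp
  · right
    subst h
    refine ⟨k, hk.of_dvd_sub (by simp), hk, ?_⟩
    simp

theorem xGraph_connected (ω : BinSeq) : (xGraph ω).Connected := by
  have key : ∀ (n : ℕ) (z : ℤ), (xGraph ω).Reachable z (z + n) := by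
    intro n z
    induction n with
    | zero => simp
    | succ n ih =>
      refine ih.trans ?_
      have := (xGraph_adj_add_one ω (z + n)).reachable
      push_cast
      rwa [← add_assoc]
  refine ⟨fun u v => ?_⟩
  rcases le_total u v with h | h
  · obtain ⟨n, rfl⟩ := Int.le.dest h
    exact key n u
  · obtain ⟨n, rfl⟩ := Int.le.dest h
    exact (key n v).symm

theorem xGraph_bounded_valence (ω : BinSeq) (v : ℤ) :
    ((xGraph ω).neighborSet v).encard ≤ 4 := by
  obtain ⟨k, hk⟩ : ∃ k : ℕ, ∀ j, ExactDepth ω j v → j = k := by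
    by_cases h : ∃ k, ExactDepth ω k v
    · obtain ⟨k, hk⟩ := h
      refine ⟨k, fun j hj => le_antisymm ?_ ?_⟩
      · exact hk.deep_iff.1 hj.1
      · exact hj.deep_iff.1 hk.1
    · exact ⟨0, fun j hj => (h ⟨j, hj⟩).elim⟩
  have hsub : (xGraph ω).neighborSet v ⊆
      (({v + 1, v - 1, v + 2 ^ (k + 1), v - 2 ^ (k + 1)} : Finset ℤ) : Set ℤ) := by
    intro u hu
    have hu' : (xGraph ω).Adj v u := hu
    simp only [Finset.coe_insert, Finset.coe_singleton, Set.mem_insert_iff,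
      Set.mem_singleton_iff]
    rcases abs_sub_of_adj hu' with h | ⟨j, hj, -, h⟩
    · rcases (abs_eq one_pos.le).1 h with h | h <;> omega
    · obtain rfl := hk j hj
      rcases (abs_eq (by positivity)).1 h with h | h
      · right; right; left; linarith
      · right; right; right; linarith
  refine (Set.encard_le_encard hsub).trans ?_
  rw [Set.encard_coe_eq_coe_finsetCard]
  exact_mod_cast Finset.card_le_four

/-! ### Short paths: the lower bound on growth -/

theorem edist_add_mul_le {ω : BinSeq} {k : ℕ} {z : ℤ} (h : ExactDepth ω k z) (q : ℕ) :
    (xGraph ω).edist z (z + q * 2 ^ (k + 1)) ≤ (q : ℕ∞) := by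
  induction q with
  | zero => simp
  | succ q ih =>
    have h' : ExactDepth ω k (z + q * 2 ^ (k + 1)) := h.of_dvd_sub (by simp)
    have h1 := SimpleGraph.edist_eq_one_iff_adj.2 (xGraph_adj_add_pow h')
    refine (SimpleGraph.edist_triangle (v := z + q * 2 ^ (k + 1))).trans ?_
    push_cast
    refine add_le_add ih ?_
    rw [← h1, add_mul, one_mul, add_assoc]

/-- If consecutive multiples of `2 ^ j` are within distance `T`, then a vertex divisible by
`2 ^ (j + 1)` is joined to its `q`-th successor among the multiples of `2 ^ j` by moving to the
line of vertices of depth exactly `j`, following it for about `q / 2` edges, and leaving it. -/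
theorem edist_add_mul_le_of_deep {ω : BinSeq} {j T : ℕ}
    (hT : ∀ x, Deep ω j x → (xGraph ω).edist x (x + 2 ^ j) ≤ (T : ℕ∞))
    {w : ℤ} (hw : Deep ω (j + 1) w) (q : ℕ) :
    (xGraph ω).edist w (w + q * 2 ^ j) ≤ ((2 * T + q / 2 : ℕ) : ℕ∞) := by
  have h0 := hT w hw.of_succ
  have hex := hw.exactDepth_add
  rcases Nat.even_or_odd' q with ⟨p, rfl | rfl⟩
  · rcases p with _ | p
    · simp
    · have h1 := edist_add_mul_le hex p
      have hd : Deep ω j (w + 2 ^ j + p * 2 ^ (j + 1)) := (hex.of_dvd_sub (by simp)).1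
      have h2 := hT _ hd
      have e : w + 2 ^ j + p * 2 ^ (j + 1) + 2 ^ j = w + (2 * (p + 1) : ℕ) * 2 ^ j := by
        push_cast; ring
      rw [e] at h2
      calc _ ≤ _ := (SimpleGraph.edist_triangle (v := w + 2 ^ j))
        _ ≤ _ := add_le_add h0 ((SimpleGraph.edist_triangle
              (v := w + 2 ^ j + p * 2 ^ (j + 1))).trans (add_le_add h1 h2))
        _ ≤ _ := by norm_cast; omega
  · have h1 := edist_add_mul_le hex p
    have e : w + 2 ^ j + p * 2 ^ (j + 1) = w + (2 * p + 1 : ℕ) * 2 ^ j := by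
      push_cast; ring
    rw [e] at h1
    calc _ ≤ _ := (SimpleGraph.edist_triangle (v := w + 2 ^ j))
      _ ≤ _ := add_le_add h0 h1
      _ ≤ _ := by norm_cast; omega

/-- The depths `i (i + 1) / 2` at which the distance between consecutive vertices roughly
doubles. -/
def triangular : ℕ → ℕ
  | 0 => 0
  | i + 1 => triangular i + (i + 1)

theorem two_mul_triangular (i : ℕ) : 2 * triangular i = i * (i + 1) := by
  induction i with
  | zero => rfl
  | succ i ih => rw [triangular]; linarith

theorem edist_add_two_pow_triangular_le (ω : BinSeq) (i : ℕ) :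
    ∀ x, Deep ω (triangular i) x →
      (xGraph ω).edist x (x + 2 ^ triangular i) ≤ (((i + 1) * 2 ^ i : ℕ) : ℕ∞) := by
  induction i with
  | zero =>
    intro x _
    have := SimpleGraph.edist_eq_one_iff_adj.2 (xGraph_adj_add_one ω x)
    simpa [triangular] using this.le
  | succ i ih =>
    intro x hx
    have h := edist_add_mul_le_of_deep ih (hx.mono (by rw [triangular]; omega)) (2 ^ (i + 1))
    have e : x + ((2 ^ (i + 1) : ℕ) : ℤ) * 2 ^ triangular i = x + 2 ^ triangular (i + 1) := by
      rw [triangular]; push_cast; ring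
    rw [e] at h
    refine h.trans ?_
    norm_cast
    have : 2 ^ (i + 1) / 2 = 2 ^ i := by rw [pow_succ]; simp
    rw [this, pow_succ]
    nlinarith [Nat.zero_le (2 ^ i)]

/-- Every vertex is close to the last vertex of depth at least `i (i + 1) / 2` before it: going up
through the depths `j (j + 1) / 2`, the stage from `j` to `j + 1` costs at most
`2 (j + 1) 2 ^ j + 2 ^ j`. -/
theorem exists_deep_floor_edist_le (ω : BinSeq) (v : ℤ) (i : ℕ) :
    ∃ w, Deep ω (triangular i) w ∧ w ≤ v ∧ v < w + 2 ^ triangular i ∧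
      (xGraph ω).edist v w ≤ ((2 * (i + 1) * 2 ^ i : ℕ) : ℕ∞) := by
  induction i with
  | zero => exact ⟨v, deep_zero ω v, le_rfl, by simp, by simp⟩
  | succ i ih =>
    obtain ⟨u, hu, huv, hvu, hd⟩ := ih
    obtain ⟨w, hw, hwu, huw⟩ := exists_deep_floor ω (triangular (i + 1)) u
    have hpos : (0 : ℤ) < 2 ^ triangular i := by positivity
    obtain ⟨q, hq⟩ := (hw.mono (by rw [triangular]; omega) : Deep ω (triangular i) w).dvd_sub hu
    have hq0 : 0 ≤ q := by nlinarith
    lift q to ℕ using hq0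
    have hpow : (2 : ℤ) ^ triangular (i + 1) = 2 ^ triangular i * 2 ^ (i + 1) := by
      rw [triangular, pow_add]
    have hq1 : (q : ℤ) < 2 ^ (i + 1) := by
      by_contra! hc
      nlinarith
    have hq2 : q < 2 ^ (i + 1) := by exact_mod_cast hq1
    refine ⟨w, hw, hwu.trans huv, ?_, ?_⟩
    · nlinarith
    · have h := edist_add_mul_le_of_deep (edist_add_two_pow_triangular_le ω i)
        (hw.mono (by rw [triangular]; omega)) q
      have e : w + (q : ℤ) * 2 ^ triangular i = u := by linarith
      rw [e, SimpleGraph.edist_comm] at h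
      refine (SimpleGraph.edist_triangle (v := u)).trans ((add_le_add hd h).trans ?_)
      norm_cast
      rw [pow_succ] at hq2 ⊢
      have : q / 2 < 2 ^ i := by omega
      nlinarith

/-- A ball of radius `(i + 1) 2 ^ (i + 2)` contains a dyadic interval of length
`2 ^ (i (i + 1) / 2)`, namely the one around its centre. -/
theorem exists_interval_subset_growthBall (ω : BinSeq) (v : ℤ) (i : ℕ) :
    ∃ w : ℤ, Set.Ico w (w + 2 ^ triangular i) ⊆
      (xGraph ω).growthBall v ((i + 1) * 2 ^ (i + 2)) := by
  obtain ⟨w, hw, h1, h2, h3⟩ := exists_deep_floor_edist_le ω v i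
  refine ⟨w, fun u hu => ?_⟩
  obtain ⟨w', hw', h1', h2', h3'⟩ := exists_deep_floor_edist_le ω u i
  have hpos : (0 : ℤ) < 2 ^ triangular i := by positivity
  obtain rfl : w' = w := by
    obtain ⟨c, hc⟩ := hw.dvd_sub hw'
    have hu2 := hu.2
    have hu1 := hu.1
    have : c < 1 := by by_contra! h; nlinarith
    have : -1 < c := by by_contra! h; nlinarith
    obtain rfl : c = 0 := by omega
    linarith
  rw [SimpleGraph.edist_comm] at h3'
  show (xGraph ω).edist v u ≤ _
  refine (SimpleGraph.edist_triangle (v := w')).trans ((add_le_add h3 h3').trans ?_)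
  norm_cast
  rw [pow_add]
  linarith

/-! ### Vertices of different large depths are far apart: the upper bound on growth -/

theorem abs_sub_le_of_steps {f : ℕ → ℤ} {s t : ℕ} {B : ℤ} (hst : s ≤ t)
    (h : ∀ i, s ≤ i → i < t → |f (i + 1) - f i| ≤ B) : |f t - f s| ≤ ((t : ℤ) - s) * B := by
  induction t, hst using Nat.le_induction with
  | base => simp
  | succ t hst ih =>
    have h1 := ih fun i hi hit => h i hi (by omega)
    have h2 := h t hst (by omega)
    have h3 := abs_sub_le (f (t + 1)) (f t) (f s)
    push_cast
    linarith

theorem eq_of_dvd_sub_of_abs_lt {k : ℕ} {u v : ℤ} (h : (2 : ℤ) ^ k ∣ v - u)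
    (hlt : |v - u| < 2 ^ k) : u = v := by
  have := Int.eq_zero_of_abs_lt_dvd h hlt
  linarith

theorem ExactDepth.deep_iff_deep {ω : BinSeq} {k : ℕ} {u v : ℤ} (hu : ExactDepth ω k u)
    (hv : ExactDepth ω k v) (m : ℕ) : Deep ω m u ↔ Deep ω m v := by
  rw [hu.deep_iff, hv.deep_iff]

/-- The ends of an edge have the same depth as soon as both have positive depth. -/
theorem deep_iff_of_adj {ω : BinSeq} {k : ℕ} (hk : 0 < k) {u v : ℤ} (h : (xGraph ω).Adj u v)
    (hu : Deep ω k u) (hv : Deep ω k v) (m : ℕ) : Deep ω m u ↔ Deep ω m v := by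
  rcases abs_sub_of_adj h with h1 | ⟨j, hj, hj', -⟩
  · have := eq_of_dvd_sub_of_abs_lt (hu.dvd_sub hv) (by
      rw [h1]; exact one_lt_pow₀ (by norm_num) hk.ne')
    rw [this]
  · exact hj.deep_iff_deep hj' m

/-- A path with at most `2 ^ r` edges between two vertices of depth at least
`(r + 1) (r + 2) / 2` joins vertices of equal depth (finite or infinite). -/
theorem deep_iff_of_path (ω : BinSeq) (r : ℕ) (f : ℕ → ℤ) :
    ∀ s t, s ≤ t → t ≤ s + 2 ^ r → (∀ i, s ≤ i → i < t → (xGraph ω).Adj (f i) (f (i + 1))) →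
      Deep ω (triangular (r + 1)) (f s) → Deep ω (triangular (r + 1)) (f t) →
      ∀ m, Deep ω m (f s) ↔ Deep ω m (f t) := by
  induction r with
  | zero =>
    intro s t hst hlen hadj hs ht m
    obtain rfl | rfl : t = s ∨ t = s + 1 := by simp at hlen; omega
    · rfl
    · exact deep_iff_of_adj (by decide) (hadj s le_rfl (by omega)) hs ht m
  | succ r ihr =>
    intro s t hst
    induction hd : t - s using Nat.strong_induction_on generalizing s t with
    | _ d ihd =>
    intro hlen hadj hs ht m
    have hK : triangular (r + 1 + 1) = triangular (r + 1) + (r + 2) := rfl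
    by_cases hint : ∃ x, s < x ∧ x < t ∧ Deep ω (triangular (r + 1 + 1)) (f x)
    · obtain ⟨x, hsx, hxt, hx⟩ := hint
      refine (ihd (x - s) (by omega) s x hsx.le rfl (by omega)
        (fun i hi hix => hadj i hi (by omega)) hs hx m).trans ?_
      exact ihd (t - x) (by omega) x t hxt.le rfl (by omega)
        (fun i hi hix => hadj i (by omega) hix) hx ht m
    · push Not at hint
      obtain rfl | rfl | hst2 : t = s ∨ t = s + 1 ∨ s + 2 ≤ t := by omega
      · rfl
      · exact deep_iff_of_adj (by omega) (hadj s le_rfl (by omega)) hs ht m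
      by_cases hbig : ∃ x k, s < x ∧ x < t ∧ ExactDepth ω k (f x) ∧ triangular (r + 1) ≤ k
      · -- Both halves of the path change the depth, so each has more than `2 ^ r` edges.
        exfalso
        obtain ⟨x, k, hsx, hxt, hx, hk⟩ := hbig
        have hkK : k + 1 ≤ triangular (r + 1 + 1) := by
          by_contra! hc
          exact hint x hsx hxt (hx.deep_iff.2 (by omega))
        have hxK : Deep ω (triangular (r + 1)) (f x) := hx.deep_iff.2 hk
        rw [pow_succ] at hlen
        obtain hle | hle : x ≤ s + 2 ^ r ∨ t ≤ x + 2 ^ r := by omega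
        · exact hx.2 ((ihr s x hsx.le hle (fun i hi hix => hadj i hi (by omega))
            (hs.mono (by omega)) hxK (k + 1)).1 (hs.mono hkK))
        · exact hx.2 ((ihr x t hxt.le hle (fun i hi hix => hadj i (by omega) hix)
            hxK (ht.mono (by omega)) (k + 1)).2 (ht.mono hkK))
      · -- All edges are too short for the path to reach another multiple of `2 ^ K`.
        have hstep : ∀ i, s ≤ i → i < t → |f (i + 1) - f i| ≤ 2 ^ triangular (r + 1) := by
          intro i hi hit
          rcases abs_sub_of_adj (hadj i hi hit) with h | ⟨k, hk, hk', h⟩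
          · rw [h]; exact one_le_pow₀ (by norm_num)
          · rw [h]
            refine pow_le_pow_right₀ (by norm_num) ?_
            by_contra! hc
            rcases hi.lt_or_eq with hlt | rfl
            · exact hbig ⟨i, k, hlt, hit, hk, by omega⟩
            · exact hbig ⟨s + 1, k, by omega, by omega, hk', by omega⟩
        have hdist := abs_sub_le_of_steps hst hstep
        have hlen' : (t : ℤ) - s ≤ 2 ^ (r + 1) := by
          have : (t : ℤ) ≤ s + 2 ^ (r + 1) := by exact_mod_cast hlen
          linarith
        have hpos : (0 : ℤ) < 2 ^ triangular (r + 1) := by positivity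
        have hlt : (2 : ℤ) ^ (r + 1) * 2 ^ triangular (r + 1) < 2 ^ triangular (r + 1 + 1) := by
          rw [hK, ← pow_add]
          exact pow_lt_pow_right₀ (by norm_num) (by omega)
        rw [eq_of_dvd_sub_of_abs_lt (hs.dvd_sub ht) (by nlinarith)]

theorem deep_iff_of_edist_le {ω : BinSeq} {r : ℕ} {u v : ℤ}
    (h : (xGraph ω).edist u v ≤ ((2 ^ r : ℕ) : ℕ∞)) (hu : Deep ω (triangular (r + 1)) u)
    (hv : Deep ω (triangular (r + 1)) v) (m : ℕ) : Deep ω m u ↔ Deep ω m v := by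
  obtain ⟨p, hp⟩ := (xGraph_connected ω).exists_walk_length_eq_edist u v
  rw [← hp] at h
  have hlen : p.length ≤ 2 ^ r := by exact_mod_cast h
  have := deep_iff_of_path ω r p.getVert 0 p.length (Nat.zero_le _) (by omega)
    (fun i _ hi => p.adj_getVert_succ hi)
  simp only [SimpleGraph.Walk.getVert_zero, SimpleGraph.Walk.getVert_length] at this
  exact this hu hv m

/-- All edges in a ball of radius `n`, except those of a single length `2 ^ d`, have length
at most `2 ^ K`; hence an endpoint of a path is determined by the number of steps of length
`2 ^ d` and by the contribution of the short steps. -/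
theorem growthBall_subset {n r : ℕ} (hn : 2 * n ≤ 2 ^ r) (ω : BinSeq) (v : ℤ) :
    ∃ d : ℕ, (xGraph ω).growthBall v n ⊆
      ((Finset.Icc (-n : ℤ) n ×ˢ Finset.Icc (-(n * 2 ^ triangular (r + 1)) : ℤ)
        (n * 2 ^ triangular (r + 1))).image fun p : ℤ × ℤ => v + p.1 * 2 ^ d + p.2 :
          Finset ℤ) := by
  obtain ⟨d, hd⟩ : ∃ d : ℕ, ∀ x ∈ (xGraph ω).growthBall v n, ∀ k,
      triangular (r + 1) ≤ k → ExactDepth ω k x → k + 1 = d := by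
    by_cases h : ∃ x ∈ (xGraph ω).growthBall v n, ∃ k, triangular (r + 1) ≤ k ∧ ExactDepth ω k x
    · obtain ⟨x, hx, k, hk, hxk⟩ := h
      refine ⟨k + 1, fun y hy j hj hyj => ?_⟩
      have hxy : (xGraph ω).edist x y ≤ ((2 ^ r : ℕ) : ℕ∞) := by
        have hx' : (xGraph ω).edist x v ≤ n := by rw [SimpleGraph.edist_comm]; exact hx
        refine (SimpleGraph.edist_triangle (v := v)).trans ((add_le_add hx' hy).trans ?_)
        norm_cast
        omega
      have key := deep_iff_of_edist_le hxy (hxk.deep_iff.2 hk) (hyj.deep_iff.2 hj)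
      have h1 := hyj.deep_iff.1 ((key k).1 hxk.1)
      have h2 := hxk.deep_iff.1 ((key j).2 hyj.1)
      omega
    · exact ⟨0, fun y hy j hj hyj => (h ⟨y, hy, j, hj, hyj⟩).elim⟩
  refine ⟨d, fun u hu => ?_⟩
  obtain ⟨p, hp⟩ := (xGraph_connected ω).exists_walk_length_eq_edist v u
  have hlen : p.length ≤ n := by
    have : (p.length : ℕ∞) ≤ n := hp ▸ hu
    exact_mod_cast this
  have key : ∀ t ≤ p.length, (xGraph ω).edist v (p.getVert t) ≤ (t : ℕ∞) ∧
      ∃ m s : ℤ, |m| ≤ t ∧ |s| ≤ t * 2 ^ triangular (r + 1) ∧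
        p.getVert t = v + m * 2 ^ d + s := by
    intro t ht
    induction t with
    | zero => exact ⟨by simp, 0, 0, by simp, by simp, by simp⟩
    | succ t ih =>
      obtain ⟨h1, m, s, hm, hs, heq⟩ := ih (by omega)
      have hadj := p.adj_getVert_succ (i := t) (by omega)
      constructor
      · refine (SimpleGraph.edist_triangle (v := p.getVert t)).trans ?_
        rw [SimpleGraph.edist_eq_one_iff_adj.2 hadj]
        push_cast
        exact add_le_add h1 le_rfl
      have hshort : |p.getVert (t + 1) - p.getVert t| ≤ 2 ^ triangular (r + 1) →
          ∃ m s : ℤ, |m| ≤ (t + 1 : ℕ) ∧ |s| ≤ (t + 1 : ℕ) * 2 ^ triangular (r + 1) ∧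
            p.getVert (t + 1) = v + m * 2 ^ d + s := by
        intro hle
        refine ⟨m, s + (p.getVert (t + 1) - p.getVert t), ?_, ?_, ?_⟩
        · push_cast; linarith
        · have := abs_add_le s (p.getVert (t + 1) - p.getVert t)
          push_cast; linarith
        · linarith
      rcases abs_sub_of_adj hadj with h | ⟨k, hk, -, h⟩
      · exact hshort (by rw [h]; exact one_le_pow₀ (by norm_num))
      · by_cases hkK : triangular (r + 1) ≤ k
        · have hball : p.getVert t ∈ (xGraph ω).growthBall v n :=
            h1.trans (by exact_mod_cast (by omega : t ≤ n))
          rw [hd _ hball k hkK hk] at h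
          have hs' : |s| ≤ (t + 1 : ℕ) * 2 ^ triangular (r + 1) := by
            have : (0 : ℤ) < 2 ^ triangular (r + 1) := by positivity
            push_cast; linarith
          rcases (abs_eq (by positivity)).1 h with h | h
          · refine ⟨m + 1, s, ?_, hs', by linarith⟩
            have := abs_add_le m 1
            rw [abs_one] at this
            push_cast; linarith
          · refine ⟨m - 1, s, ?_, hs', by linarith⟩
            have := abs_sub m 1
            rw [abs_one] at this
            push_cast; linarith
        · refine hshort ?_
          rw [h]
          exact pow_le_pow_right₀ (by norm_num) (by omega)
  obtain ⟨-, m, s, hm, hs, heq⟩ := key p.length le_rfl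
  rw [SimpleGraph.Walk.getVert_length] at heq
  have hlen' : (p.length : ℤ) ≤ n := by exact_mod_cast hlen
  have hpos : (0 : ℤ) < 2 ^ triangular (r + 1) := by positivity
  refine Finset.mem_coe.2 (Finset.mem_image.2 ⟨(m, s), ?_, heq.symm⟩)
  rw [Finset.mem_product, Finset.mem_Icc, Finset.mem_Icc, ← abs_le, ← abs_le]
  exact ⟨hm.trans hlen', hs.trans (by gcongr)⟩

theorem growthBall_finite (ω : BinSeq) (v : ℤ) (n : ℕ) :
    ((xGraph ω).growthBall v n).Finite := by
  obtain ⟨d, hd⟩ := growthBall_subset (Nat.lt_two_pow_self (n := 2 * n)).le ω v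
  exact (Finset.finite_toSet _).subset hd

/-- The number of points allowed by `growthBall_subset` is at most
`2 ^ (2 * r + 2 + K)` with `2 * K = (r + 1) * (r + 2)`. -/
theorem growth_le {n r : ℕ} (hn : 2 * n ≤ 2 ^ r) (ω : BinSeq) (v : ℤ) :
    (xGraph ω).growth v n ≤ 2 ^ (r + 3) ^ 2 := by
  obtain ⟨d, hd⟩ := growthBall_subset hn ω v
  have h1 := Set.ncard_le_ncard hd (Finset.finite_toSet _)
  rw [Set.ncard_coe_finset] at h1
  have h2 := h1.trans Finset.card_image_le
  rw [Finset.card_product, Int.card_Icc, Int.card_Icc] at h2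
  have e1 : ((n : ℤ) + 1 - -n).toNat = 2 * n + 1 := by omega
  have e2 : ((n : ℤ) * 2 ^ triangular (r + 1) + 1 - -(n * 2 ^ triangular (r + 1))).toNat
      = 2 * n * 2 ^ triangular (r + 1) + 1 := by
    have : ((n : ℤ) * 2 ^ triangular (r + 1) + 1 - -(n * 2 ^ triangular (r + 1)))
      = (2 * n * 2 ^ triangular (r + 1) + 1 : ℕ) := by push_cast; ring
    rw [this, Int.toNat_natCast]
  rw [e1, e2] at h2
  refine h2.trans ?_
  have hp : 1 ≤ 2 ^ triangular (r + 1) := Nat.one_le_two_pow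
  have hr : 1 ≤ 2 ^ r := Nat.one_le_two_pow
  calc (2 * n + 1) * (2 * n * 2 ^ triangular (r + 1) + 1)
      ≤ (2 * 2 ^ r) * (2 * (2 ^ r * 2 ^ triangular (r + 1))) := by
        gcongr
        · omega
        · have := Nat.mul_le_mul hn (le_refl (2 ^ triangular (r + 1)))
          have := Nat.mul_le_mul hr hp
          omega
    _ = 2 ^ (2 * r + 2 + triangular (r + 1)) := by ring
    _ ≤ 2 ^ (r + 3) ^ 2 := by
        have := two_mul_triangular (r + 1)
        exact pow_le_pow_right₀ (by norm_num) (by nlinarith)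

/-- The witness `i` is the largest one for which `exists_interval_subset_growthBall` applies to
balls of radius `n`, or `0` if there is none. -/
theorem exists_le_growth (ω : BinSeq) (v : ℤ) {n : ℕ} (hn : 1 ≤ n) :
    ∃ i, 2 ^ i ≤ n ∧ n < (i + 2) * 2 ^ (i + 3) ∧ 2 ^ triangular i ≤ (xGraph ω).growth v n := by
  by_cases h4 : n < 4
  · refine ⟨0, by simpa using hn, by omega, ?_⟩
    have : v ∈ (xGraph ω).growthBall v n := by simp [SimpleGraph.growthBall]
    exact (Set.ncard_pos (growthBall_finite ω v n)).2 ⟨v, this⟩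
  · have hex : ∃ i, n < (i + 2) * 2 ^ (i + 3) := by
      refine ⟨n, Nat.lt_two_pow_self.trans_le ?_⟩
      rw [pow_add]
      nlinarith [Nat.zero_le (2 ^ n)]
    classical
    have hlt := Nat.find_spec hex
    have hge : (Nat.find hex + 1) * 2 ^ (Nat.find hex + 2) ≤ n := by
      rcases h : Nat.find hex with _ | i
      · simpa using h4
      · have := Nat.find_min hex (m := i) (by omega)
        simpa using this
    refine ⟨Nat.find hex, ?_, hlt, ?_⟩
    · refine le_trans ?_ hge
      rw [pow_add]
      nlinarith [Nat.zero_le (2 ^ Nat.find hex)]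
    · obtain ⟨w, hw⟩ := exists_interval_subset_growthBall ω v (Nat.find hex)
      have hsub : Set.Ico w (w + 2 ^ triangular (Nat.find hex)) ⊆
          (xGraph ω).growthBall v n := by
        intro u hu
        have hle : (xGraph ω).edist v u ≤ _ := hw hu
        exact hle.trans (by exact_mod_cast hge)
      have h1 := Set.ncard_le_ncard hsub (growthBall_finite ω v n)
      rw [← Finset.coe_Ico, Set.ncard_coe_finset, Int.card_Ico] at h1
      have e : (w + 2 ^ triangular (Nat.find hex) - w).toNat = 2 ^ triangular (Nat.find hex) := by
        have : w + 2 ^ triangular (Nat.find hex) - w = (2 ^ triangular (Nat.find hex) : ℕ) := by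
          push_cast; ring
        rw [this, Int.toNat_natCast]
      rwa [e] at h1

/-! ### The isomorphism between `X_ω` and `Γ_ω` -/

theorem prefixVal_cons (n : ℕ) (x : Bool) (ω : BinSeq) :
    prefixVal (n + 1) (cons x ω) = (x.toNat : ℤ) + 2 * prefixVal n ω := by
  rw [prefixVal, Finset.sum_range_succ', prefixVal, Finset.mul_sum, add_comm]
  simp only [cons, pow_zero, mul_one]
  congr 1
  refine Finset.sum_congr rfl fun i _ => ?_
  ring

theorem dvd_prefixVal_a (n : ℕ) :
    ∀ ω : BinSeq, (2 : ℤ) ^ n ∣ prefixVal n (a ω) - prefixVal n ω - 1 := by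
  induction n with
  | zero => simp
  | succ n ih =>
    intro ω
    rw [← cons_head_tail ω]
    cases ω 0
    · rw [a_cons_zero, prefixVal_cons, prefixVal_cons]
      simp
    · rw [a_cons_one, prefixVal_cons, prefixVal_cons]
      obtain ⟨m, hm⟩ := ih ω.tail
      refine ⟨m, ?_⟩
      simp only [Bool.toNat_false, Bool.toNat_true]
      push_cast
      rw [pow_succ]
      linear_combination 2 * hm

theorem dvd_prefixVal_a_pow (n m : ℕ) (ω : BinSeq) :
    (2 : ℤ) ^ n ∣ prefixVal n ((a ^ m) ω) - prefixVal n ω - m := by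
  induction m with
  | zero => simp
  | succ m ih =>
    rw [pow_succ', Equiv.Perm.mul_apply]
    convert Int.dvd_add (dvd_prefixVal_a n ((a ^ m) ω)) ih using 1
    push_cast; ring

/-- The transformation `a` is addition of `1` in the `2`-adic integers. -/
theorem dvd_prefixVal_a_zpow (n : ℕ) (z : ℤ) (ω : BinSeq) :
    (2 : ℤ) ^ n ∣ prefixVal n ((a ^ z) ω) - prefixVal n ω - z := by
  obtain ⟨m, rfl | rfl⟩ := z.eq_nat_or_neg
  · simpa using dvd_prefixVal_a_pow n m ω
  · have h := dvd_prefixVal_a_pow n m ((a ^ (-(m : ℤ))) ω)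
    have e : (a ^ m) ((a ^ (-(m : ℤ))) ω) = ω := by simp
    rw [e] at h
    convert (Int.dvd_neg).2 h using 1
    ring

theorem deep_a_zpow {ω : BinSeq} {k : ℕ} {z : ℤ} : Deep ((a ^ z) ω) k 0 ↔ Deep ω k z := by
  rw [Deep, Deep]
  have h := dvd_prefixVal_a_zpow k z ω
  rw [show (0 : ℤ) + prefixVal k ((a ^ z) ω) = (z + prefixVal k ω) +
    (prefixVal k ((a ^ z) ω) - prefixVal k ω - z) by ring]
  exact dvd_add_left h

theorem exactDepth_a_zpow {ω : BinSeq} {k : ℕ} {z : ℤ} :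
    ExactDepth ((a ^ z) ω) k 0 ↔ ExactDepth ω k z := by
  rw [ExactDepth, ExactDepth, deep_a_zpow, deep_a_zpow]

theorem a_zpow_apply_injective (ω : BinSeq) : Function.Injective fun z : ℤ => (a ^ z) ω := by
  intro z z' h
  have h1 := dvd_prefixVal_a_zpow (z' - z).natAbs z ω
  have h2 := dvd_prefixVal_a_zpow (z' - z).natAbs z' ω
  simp only at h
  rw [h] at h1
  have h3 := Int.dvd_sub h1 h2
  refine eq_of_dvd_sub_of_abs_lt (k := (z' - z).natAbs) ?_ ?_
  · convert h3 using 1; ring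
  · rw [Int.abs_eq_natAbs]
    exact_mod_cast Nat.lt_two_pow_self

theorem deep_cons_false {ω : BinSeq} {k : ℕ} : Deep (cons false ω) (k + 1) 0 ↔ Deep ω k 0 := by
  rw [Deep, Deep, prefixVal_cons, pow_succ']
  simp only [Bool.toNat_false, Nat.cast_zero, zero_add]
  exact mul_dvd_mul_iff_left two_ne_zero

theorem not_deep_cons_true {ω : BinSeq} {k : ℕ} : ¬ Deep (cons true ω) (k + 1) 0 := by
  rw [Deep, prefixVal_cons, pow_succ']
  rintro ⟨m, hm⟩
  simp only [Bool.toNat_true, Nat.cast_one] at hm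
  rw [mul_assoc] at hm
  omega

theorem a_pow_two_mul_cons (m : ℕ) (x : Bool) (ω : BinSeq) :
    (a ^ (2 * m)) (cons x ω) = cons x ((a ^ m) ω) := by
  have h : ∀ ω, (a ^ 2) (cons x ω) = cons x (a ω) := by
    intro ω
    rw [pow_two, Equiv.Perm.mul_apply]
    cases x
    · rw [a_cons_zero, a_cons_one]
    · rw [a_cons_one, a_cons_zero]
  induction m with
  | zero => rfl
  | succ m ih =>
    rw [Nat.mul_succ, add_comm, pow_add, Equiv.Perm.mul_apply, ih, h, pow_succ',
      Equiv.Perm.mul_apply]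

/-- On `0^k 1 w` the transformation `b` is addition of `2 ^ (k + 1)`. -/
theorem b_apply_of_exactDepth (k : ℕ) :
    ∀ ω : BinSeq, ExactDepth ω k 0 → b ω = (a ^ (2 ^ (k + 1))) ω := by
  induction k with
  | zero =>
    intro ω h
    rw [← cons_head_tail ω] at h ⊢
    cases h0 : ω 0
    · rw [h0] at h
      exact (h.2 (deep_cons_false.2 (deep_zero _ _))).elim
    · rw [b_cons_one, pow_succ', pow_zero, a_pow_two_mul_cons, pow_one]
  | succ k ih =>
    intro ω h
    rw [← cons_head_tail ω] at h ⊢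
    cases h0 : ω 0
    · rw [h0, ExactDepth, deep_cons_false, deep_cons_false] at h
      rw [b_cons_zero, ih _ h, pow_succ' 2 (k + 1), a_pow_two_mul_cons]
    · rw [h0] at h
      exact (not_deep_cons_true h.1).elim

theorem bLetter_of_deep (n : ℕ) :
    ∀ ω : BinSeq, (∀ k, Deep ω k 0) → bLetter n ω = ω n := by
  induction n with
  | zero => exact fun ω _ => rfl
  | succ n ih =>
    intro ω h
    have h0 : ω 0 = false := by
      by_contra hc
      rw [Bool.not_eq_false] at hc
      have h1 := h 1
      rw [← cons_head_tail ω, hc] at h1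
      exact not_deep_cons_true h1
    have ht : ∀ k, Deep ω.tail k 0 := by
      intro k
      have h1 := h (k + 1)
      rwa [← cons_head_tail ω, h0, deep_cons_false] at h1
    have hrec : bLetter (n + 1) ω = bLetter n ω.tail := by simp [bLetter, h0]
    exact hrec.trans (ih ω.tail ht)

/-- The only point of `{0,1}^∞` without a depth is `0^∞`, and `b` fixes it. -/
theorem b_apply_of_forall_not_exactDepth {ω : BinSeq} (h : ∀ k, ¬ ExactDepth ω k 0) :
    b ω = ω := by
  have hd : ∀ k, Deep ω k 0 := by
    intro k
    induction k with
    | zero => exact deep_zero _ _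
    | succ k ih =>
      by_contra hc
      exact h k ⟨ih, hc⟩
  funext n
  exact bLetter_of_deep n ω hd

theorem b_a_zpow_apply_iff {ω : BinSeq} {z z' : ℤ} :
    b ((a ^ z) ω) = (a ^ z') ω ↔
      (∃ k, ExactDepth ω k z ∧ z' = z + 2 ^ (k + 1)) ∨ (z' = z ∧ ∀ k, ¬ ExactDepth ω k z) := by
  by_cases h : ∃ k, ExactDepth ω k z
  · obtain ⟨k, hk⟩ := h
    rw [b_apply_of_exactDepth k _ (exactDepth_a_zpow.2 hk), ← zpow_natCast,
      ← Equiv.Perm.mul_apply, ← zpow_add, (a_zpow_apply_injective ω).eq_iff]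
    push_cast
    constructor
    · exact fun h => Or.inl ⟨k, hk, by linarith⟩
    · rintro (⟨j, hj, h⟩ | ⟨-, h⟩)
      · obtain rfl : j = k := le_antisymm (hk.deep_iff.1 hj.1) (hj.deep_iff.1 hk.1)
        linarith
      · exact (h k hk).elim
  · push Not at h
    rw [b_apply_of_forall_not_exactDepth fun k hk => h k (exactDepth_a_zpow.1 hk),
      (a_zpow_apply_injective ω).eq_iff]
    constructor
    · exact fun e => Or.inr ⟨e.symm, h⟩
    · rintro (⟨j, hj, -⟩ | ⟨e, -⟩)
      · exact (h j hj).elim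
      · exact e.symm

/-- Every orbit of `G` is an orbit of the cyclic subgroup generated by `a`. -/
theorem exists_a_zpow_of_mem_G {g : Equiv.Perm BinSeq} (hg : g ∈ G) :
    ∀ ω, ∃ z : ℤ, g ω = (a ^ z) ω := by
  induction hg using Subgroup.closure_induction with
  | mem g hg =>
    intro ω
    rcases hg with rfl | rfl
    · exact ⟨1, by simp⟩
    · by_cases h : ∃ k, ExactDepth ω k 0
      · obtain ⟨k, hk⟩ := h
        exact ⟨(2 ^ (k + 1) : ℕ), by rw [b_apply_of_exactDepth k ω hk, zpow_natCast]⟩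
      · push Not at h
        exact ⟨0, by rw [b_apply_of_forall_not_exactDepth h]; simp⟩
  | one => exact fun ω => ⟨0, by simp⟩
  | mul g h _ _ ihg ihh =>
    intro ω
    obtain ⟨z, hz⟩ := ihh ω
    obtain ⟨z', hz'⟩ := ihg (h ω)
    exact ⟨z' + z, by rw [Equiv.Perm.mul_apply, hz', hz, zpow_add, Equiv.Perm.mul_apply]⟩
  | inv g _ ih =>
    intro ω
    obtain ⟨z, hz⟩ := ih (g⁻¹ ω)
    refine ⟨-z, ?_⟩
    rw [← Equiv.Perm.mul_apply, mul_inv_cancel, Equiv.Perm.one_apply] at hz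
    conv_rhs => rw [hz]
    rw [← Equiv.Perm.mul_apply, zpow_neg, inv_mul_cancel, Equiv.Perm.one_apply]

/-- The vertex `a ^ z (ω)` of the orbital Schreier graph. -/
def orbitVertex (ω : BinSeq) (z : ℤ) : OrbitalSchreierGraph ω :=
  ⟨⟨(gen Gen.a ^ z) • ω, MulAction.mem_orbit _ _⟩⟩

theorem orbitVertex_val (ω : BinSeq) (z : ℤ) :
    ((orbitVertex ω z).toVertex : BinSeq) = (a ^ z) ω := by
  show (gen Gen.a ^ z) • ω = _
  rw [Subgroup.smul_def, Equiv.Perm.smul_def, Subgroup.coe_zpow]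
  rfl

theorem orbitVertex_bijective (ω : BinSeq) : Function.Bijective (orbitVertex ω) := by
  constructor
  · intro z z' h
    refine a_zpow_apply_injective ω ?_
    simp only
    rw [← orbitVertex_val, ← orbitVertex_val, h]
  · rintro ⟨⟨η, ⟨g, hg⟩, rfl⟩⟩
    obtain ⟨z, hz⟩ := exists_a_zpow_of_mem_G hg ω
    refine ⟨z, Quiver.SchreierGraph.ext (Subtype.ext ?_)⟩
    rw [orbitVertex_val, ← hz]
    rfl

theorem nonempty_hom_iff {ω : BinSeq} (x y : OrbitalSchreierGraph ω) :
    Nonempty (x ⟶ y) ↔ a (x.toVertex : BinSeq) = y.toVertex ∨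
      b (x.toVertex : BinSeq) = y.toVertex := by
  constructor
  · rintro ⟨⟨s, hs⟩⟩
    have hs' := congrArg (fun t : OrbitalSchreierGraph ω => (t.toVertex : BinSeq)) hs
    cases s
    · exact Or.inl hs'
    · exact Or.inr hs'
  · rintro (h | h)
    · exact ⟨⟨Gen.a, Quiver.SchreierGraph.ext (Subtype.ext h)⟩⟩
    · exact ⟨⟨Gen.b, Quiver.SchreierGraph.ext (Subtype.ext h)⟩⟩

theorem nonempty_hom_orbitVertex_iff {ω : BinSeq} {z z' : ℤ} (hne : z ≠ z') :
    Nonempty (orbitVertex ω z ⟶ orbitVertex ω z') ↔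
      (z' = z + 1 ∨ ∃ k, ExactDepth ω k z ∧ z' = z + 2 ^ (k + 1)) := by
  rw [nonempty_hom_iff, orbitVertex_val, orbitVertex_val, b_a_zpow_apply_iff,
    ← Equiv.Perm.mul_apply, ← zpow_one_add, (a_zpow_apply_injective ω).eq_iff]
  have h1 : (1 + z = z') ↔ z' = z + 1 := by omega
  rw [h1, or_iff_left (b := z' = z ∧ _) fun h => hne h.1.symm]

/-- The isomorphism `z ↦ a ^ z (ω)` from `X_ω` to the orbital Schreier graph `Γ_ω`. -/
noncomputable def xGraphIso (ω : BinSeq) :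
    xGraph ω ≃g underlyingGraph (OrbitalSchreierGraph ω) where
  toEquiv := Equiv.ofBijective (orbitVertex ω) (orbitVertex_bijective ω)
  map_rel_iff' := by
    intro z z'
    simp only [Equiv.ofBijective_apply, underlyingGraph, xGraph, SimpleGraph.fromRel_adj,
      (orbitVertex_bijective ω).1.ne_iff, xGraph_rel_iff]
    refine and_congr_right fun hne => ?_
    rw [nonempty_hom_orbitVertex_iff hne, nonempty_hom_orbitVertex_iff hne.symm]

end BinSeq

/-! ### Growth and graph isomorphisms -/

namespace SimpleGraph

variable {V W : Type*} {X : SimpleGraph V} {Y : SimpleGraph W}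

theorem edist_map_le (f : X →g Y) (u v : V) : Y.edist (f u) (f v) ≤ X.edist u v := by
  by_cases h : X.edist u v = ⊤
  · rw [h]; exact le_top
  · obtain ⟨p, hp⟩ := X.exists_walk_of_edist_ne_top h
    rw [← hp, ← p.length_map f]
    exact edist_le _

theorem edist_iso (e : X ≃g Y) (u v : V) : Y.edist (e u) (e v) = X.edist u v := by
  refine le_antisymm (edist_map_le e.toHom u v) ?_
  simpa using edist_map_le e.symm.toHom (e u) (e v)

theorem growth_iso (e : X ≃g Y) (v : V) (n : ℕ) : Y.growth (e v) n = X.growth v n := by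
  have h : Y.growthBall (e v) n = e '' X.growthBall v n := by
    ext u
    obtain ⟨w, rfl⟩ := e.surjective u
    simp [growthBall, edist_iso, e.injective.eq_iff]
  rw [growth, h, Set.ncard_image_of_injective _ e.injective, growth]

end SimpleGraph

/-! ### Estimates with real exponents -/

theorem le_rpow_logb_of_le_two_pow {n r g : ℕ} (hn : 1 ≤ n) (hr : 2 ^ r ≤ 4 * n)
    (hg : g ≤ 2 ^ (r + 3) ^ 2) :
    (g : ℝ) ≤ (32 * n : ℝ) ^ Real.logb 2 (32 * n) := by
  have hpos : (0 : ℝ) < 32 * n := by positivity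
  have hle : (2 : ℝ) ^ ((r + 3 : ℕ) : ℝ) ≤ 32 * n := by
    rw [Real.rpow_natCast, pow_add]
    have : (2 : ℝ) ^ r ≤ 4 * n := by exact_mod_cast hr
    linarith
  have hlog : ((r + 3 : ℕ) : ℝ) ≤ Real.logb 2 (32 * n) :=
    (Real.le_logb_iff_rpow_le one_lt_two hpos).2 hle
  have h0 : (0 : ℝ) ≤ ((r + 3 : ℕ) : ℝ) := Nat.cast_nonneg _
  calc (g : ℝ) ≤ ((2 ^ (r + 3) ^ 2 : ℕ) : ℝ) := by exact_mod_cast hg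
    _ = (2 : ℝ) ^ (((r + 3 : ℕ) : ℝ) * ((r + 3 : ℕ) : ℝ)) := by
        rw [← Nat.cast_mul, Real.rpow_natCast, ← pow_two]; push_cast; rfl
    _ ≤ (2 : ℝ) ^ (Real.logb 2 (32 * n) * Real.logb 2 (32 * n)) := by
        refine Real.rpow_le_rpow_of_exponent_le one_le_two ?_
        exact mul_le_mul hlog hlog h0 (h0.trans hlog)
    _ = (32 * n : ℝ) ^ Real.logb 2 (32 * n) := by
        rw [Real.rpow_mul zero_le_two, Real.rpow_logb two_pos (by norm_num) hpos]

/-- Writing `L = log₂ n`, the hypotheses on `n` give `L - log₂ L - 5 ≤ i ≤ L`, so that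
`i (i + 1) / 2` is at least `L (L / 2 - log₂ L - 5)`, which is more than the exponent needed. If
`L < log₂ L + 5` the exponent on the left is negative. -/
theorem rpow_le_of_two_pow_triangular_le {n i g : ℕ} (hn : 2 ≤ n) (h1 : 2 ^ i ≤ n)
    (h2 : n < (i + 2) * 2 ^ (i + 3))
    (hg : 2 ^ BinSeq.triangular i ≤ g) :
    (n : ℝ) ^ ((1 / 2 : ℝ) * Real.logb 2 n - Real.logb 2 (Real.logb 2 n) - 32) ≤ (g : ℝ) := by
  have hpos : (0 : ℝ) < n := by positivity
  set L := Real.logb 2 n with hL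
  set l := Real.logb 2 L with hl
  have hL1 : 1 ≤ L := by
    rw [hL, Real.le_logb_iff_rpow_le one_lt_two hpos, Real.rpow_one]
    exact_mod_cast hn
  have hl0 : 0 ≤ l := Real.logb_nonneg one_lt_two hL1
  have hiL : (i : ℝ) ≤ L := by
    rw [hL, Real.le_logb_iff_rpow_le one_lt_two hpos, Real.rpow_natCast]
    exact_mod_cast h1
  have hLi : L ≤ l + 5 + i := by
    have hlt : (n : ℝ) ≤ (4 * L) * (2 : ℝ) ^ (i + 3) := by
      have : (n : ℝ) < ((i : ℝ) + 2) * (2 : ℝ) ^ (i + 3) := by exact_mod_cast h2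
      refine this.le.trans ?_
      gcongr
      linarith
    have := Real.logb_le_logb_of_le one_lt_two hpos hlt
    have h4 : Real.logb 2 4 = 2 := by
      rw [show (4 : ℝ) = 2 ^ (2 : ℕ) by norm_num, Real.logb_pow, Real.logb_self_eq_one one_lt_two]
      norm_num
    rw [Real.logb_mul (by positivity) (by positivity), Real.logb_mul (by norm_num) (by positivity),
      Real.logb_pow, Real.logb_self_eq_one one_lt_two, h4] at this
    push_cast at this
    linarith
  have htri : 2 * (BinSeq.triangular i : ℝ) = i * (i + 1) := by
    exact_mod_cast BinSeq.two_mul_triangular i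
  have hi0 : (0 : ℝ) ≤ i := Nat.cast_nonneg i
  have key : L * ((1 / 2 : ℝ) * L - l - 32) ≤ BinSeq.triangular i := by
    rcases le_total (l + 5) L with h | h
    · have : (L - (l + 5)) * (L - (l + 5)) ≤ i * i :=
        mul_le_mul (by linarith) (by linarith) (by linarith) hi0
      nlinarith
    · have : L * ((1 / 2 : ℝ) * L - l - 32) ≤ 0 :=
        mul_nonpos_of_nonneg_of_nonpos (by linarith) (by linarith)
      nlinarith
  calc (n : ℝ) ^ ((1 / 2 : ℝ) * L - l - 32)
      = (2 : ℝ) ^ (L * ((1 / 2 : ℝ) * L - l - 32)) := by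
        rw [Real.rpow_mul zero_le_two, hL, Real.rpow_logb two_pos (by norm_num) hpos]
    _ ≤ (2 : ℝ) ^ (BinSeq.triangular i : ℝ) :=
        Real.rpow_le_rpow_of_exponent_le one_le_two key
    _ ≤ g := by rw [Real.rpow_natCast]; exact_mod_cast hg

theorem eventually_eval_le_of_lower_bound {g : ℕ → ℕ} (C : ℝ)
    (hg : ∀ n : ℕ, 2 ≤ n →
      (n : ℝ) ^ ((1 / 2 : ℝ) * Real.logb 2 n - Real.logb 2 (Real.logb 2 n) - C) ≤ (g n : ℝ))
    (P : Polynomial ℝ) : ∀ᶠ n : ℕ in atTop, P.eval (n : ℝ) ≤ (g n : ℝ) := by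
  set d := P.natDegree with hd
  have hP : ∀ᶠ x : ℝ in atTop, P.eval x ≤ x ^ (d + 1) := by
    have h1 : P.eval =o[atTop] (Polynomial.X ^ (d + 1) : Polynomial ℝ).eval := by
      refine P.isLittleO_atTop_of_degree_lt _ ?_
      rw [Polynomial.degree_X_pow]
      exact P.degree_le_natDegree.trans_lt (by exact_mod_cast Nat.lt_succ_self d)
    filter_upwards [h1.bound one_pos, eventually_ge_atTop 0] with x hx hx0
    rw [one_mul, Polynomial.eval_pow, Polynomial.eval_X, Real.norm_eq_abs, Real.norm_eq_abs,
      abs_of_nonneg (pow_nonneg hx0 _)] at hx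
    exact (le_abs_self _).trans hx
  have hE : ∀ᶠ y : ℝ in atTop, ((d + 1 : ℕ) : ℝ) ≤ (1 / 2 : ℝ) * y - Real.logb 2 y - C := by
    have hlog2 : 0 < Real.log 2 := Real.log_pos one_lt_two
    have h1 := Real.isLittleO_log_id_atTop.bound (c := Real.log 2 / 4) (by positivity)
    filter_upwards [h1, eventually_ge_atTop 0, eventually_ge_atTop (4 * (((d + 1 : ℕ) : ℝ) + C))]
      with y hy hy0 hyC
    rw [Real.norm_eq_abs, id, Real.norm_eq_abs, abs_of_nonneg hy0] at hy
    have h2 : Real.logb 2 y ≤ y / 4 := by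
      rw [Real.logb, div_le_iff₀ hlog2]
      linarith [le_abs_self (Real.log y)]
    linarith
  have hL : Tendsto (fun n : ℕ => Real.logb 2 (n : ℝ)) atTop atTop :=
    (Real.tendsto_logb_atTop one_lt_two).comp tendsto_natCast_atTop_atTop
  filter_upwards [tendsto_natCast_atTop_atTop.eventually hP, hL.eventually hE,
    eventually_ge_atTop 2] with n h1 h2 h3
  refine h1.trans (le_trans ?_ (hg n h3))
  rw [← Real.rpow_natCast]
  refine Real.rpow_le_rpow_of_exponent_le ?_ h2
  exact_mod_cast (by omega : 1 ≤ n)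

theorem eventually_le_pow_of_upper_bound {g : ℕ → ℕ} {C : ℝ} (hC : 0 < C)
    (hg : ∀ n : ℕ, 2 ≤ n → (g n : ℝ) ≤ (C * n : ℝ) ^ Real.logb 2 (C * n))
    {c : ℝ} (hc : 1 < c) : ∀ᶠ n : ℕ in atTop, (g n : ℝ) ≤ c ^ n := by
  have hlog2 : 0 < Real.log 2 := Real.log_pos one_lt_two
  have hlogc : 0 < Real.log c := Real.log_pos hc
  have h1 := (Real.isLittleO_pow_log_id_atTop (n := 2)).bound
    (c := Real.log 2 * Real.log c / C) (by positivity)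
  have ht : Tendsto (fun n : ℕ => C * (n : ℝ)) atTop atTop :=
    tendsto_natCast_atTop_atTop.const_mul_atTop hC
  filter_upwards [ht.eventually h1, eventually_ge_atTop 2] with n h2 h3
  have hn : (0 : ℝ) < n := by positivity
  refine (hg n h3).trans ?_
  rw [Real.norm_eq_abs, id, Real.norm_eq_abs, abs_of_pos (by positivity : 0 < C * n),
    abs_of_nonneg (sq_nonneg _)] at h2
  rw [Real.rpow_def_of_pos (by positivity), ← Real.rpow_natCast,
    Real.rpow_def_of_pos (by linarith), Real.exp_le_exp, Real.logb, ← mul_div_assoc,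
    div_le_iff₀ hlog2]
  have e : Real.log 2 * Real.log c / C * (C * n) = Real.log c * n * Real.log 2 := by
    field_simp
  rw [← e, ← pow_two]
  exact h2

/-! ### Intermediate growth -/

namespace BinSeq

theorem xGraph_growth_bounds (ω : BinSeq) {n : ℕ} (hn : 2 ≤ n) (z : ℤ) :
    (n : ℝ) ^ ((1 / 2 : ℝ) * Real.logb 2 n - Real.logb 2 (Real.logb 2 n) - 32) ≤
      ((xGraph ω).growth z n : ℝ) ∧
    ((xGraph ω).growth z n : ℝ) ≤ (32 * n : ℝ) ^ Real.logb 2 (32 * n) := by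
  constructor
  · obtain ⟨i, h1, h2, h3⟩ := exists_le_growth ω z (by omega : 1 ≤ n)
    exact rpow_le_of_two_pow_triangular_le hn h1 h2 h3
  · have h1 := Nat.pow_log_le_self 2 (by omega : n ≠ 0)
    have h2 := Nat.lt_pow_succ_log_self (b := 2) one_lt_two n
    refine le_rpow_logb_of_le_two_pow (r := Nat.log 2 n + 2) (by omega) ?_ (growth_le ?_ ω z)
    · rw [pow_add]; omega
    · rw [pow_add]; rw [pow_succ] at h2; omega

theorem xGraph_hasIntermediateGrowth (ω : BinSeq) : (xGraph ω).HasIntermediateGrowth where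
  connected := xGraph_connected ω
  bounded_valence := ⟨4, fun v => by exact_mod_cast xGraph_bounded_valence ω v⟩
  superpolynomial v P := eventually_eval_le_of_lower_bound 32
    (fun _ hn => (xGraph_growth_bounds ω hn v).1) P
  subexponential v _ hc := eventually_le_pow_of_upper_bound (by norm_num)
    (fun _ hn => (xGraph_growth_bounds ω hn v).2) hc

end BinSeq

theorem SimpleGraph.HasIntermediateGrowth.of_iso {V W : Type*} {X : SimpleGraph V}
    {Y : SimpleGraph W} (e : X ≃g Y) (h : X.HasIntermediateGrowth) : Y.HasIntermediateGrowth where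
  connected := e.connected_iff.1 h.connected
  bounded_valence := by
    obtain ⟨d, hd⟩ := h.bounded_valence
    refine ⟨d, fun w => ?_⟩
    obtain ⟨v, rfl⟩ := e.surjective w
    refine le_trans (le_of_eq ?_) (hd v)
    have him : Y.neighborSet (e v) = e '' X.neighborSet v := by
      ext u
      obtain ⟨w, rfl⟩ := e.surjective u
      rw [e.injective.mem_set_image, e.apply_mem_neighborSet_iff]
    rw [him, e.injective.encard_image]
  superpolynomial w P := by
    obtain ⟨v, rfl⟩ := e.surjective w
    simpa only [growth_iso] using h.superpolynomial v P
  subexponential w c hc := by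
    obtain ⟨v, rfl⟩ := e.surjective w
    simpa only [growth_iso] using h.subexponential v c hc

/-- All graphs `Γ_ω` and `X_ω` have intermediate growth, with explicit two-sided bounds that are
uniform in `ω` and in the vertex. -/
theorem theorem13 :
    (∀ ω : BinSeq,
      (underlyingGraph (BinSeq.OrbitalSchreierGraph ω)).HasIntermediateGrowth ∧
      (BinSeq.xGraph ω).HasIntermediateGrowth) ∧
    ∃ C : ℝ, 0 < C ∧ ∀ ω : BinSeq, ∀ n : ℕ, 2 ≤ n →
      (∀ v : BinSeq.OrbitalSchreierGraph ω,
        (n : ℝ) ^ ((1 / 2 : ℝ) * Real.logb 2 n - Real.logb 2 (Real.logb 2 n) - C) ≤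
          ((underlyingGraph (BinSeq.OrbitalSchreierGraph ω)).growth v n : ℝ) ∧
        ((underlyingGraph (BinSeq.OrbitalSchreierGraph ω)).growth v n : ℝ) ≤
          (C * n : ℝ) ^ Real.logb 2 (C * n)) ∧
      (∀ z : ℤ,
        (n : ℝ) ^ ((1 / 2 : ℝ) * Real.logb 2 n - Real.logb 2 (Real.logb 2 n) - C) ≤
          ((BinSeq.xGraph ω).growth z n : ℝ) ∧
        ((BinSeq.xGraph ω).growth z n : ℝ) ≤ (C * n : ℝ) ^ Real.logb 2 (C * n)) := by
  refine ⟨fun ω => ⟨(BinSeq.xGraph_hasIntermediateGrowth ω).of_iso (BinSeq.xGraphIso ω),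
    BinSeq.xGraph_hasIntermediateGrowth ω⟩, 32, by norm_num, fun ω n hn => ⟨fun v => ?_,
    fun z => BinSeq.xGraph_growth_bounds ω hn z⟩⟩
  obtain ⟨z, rfl⟩ := (BinSeq.xGraphIso ω).surjective v
  rw [SimpleGraph.growth_iso]
  exact BinSeq.xGraph_growth_bounds ω hn z
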